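/- Let $G$ be a finite, connected, regular simple graph with vertex set $V$, $|V|\ge 2$. Let $P$ be the transition matrix of the lazy simple random walk on $G$: $P(x,x)=\tfrac12$, $P(x,y)=\tfrac1{2\deg(x)}$ if $\{x,y\}$ is an edge, and $P(x,y)=0$ otherwise. Let $t_{\rm hit}(G)=\max_{x,y\in V}\mathbf E_x[\tau_y]$ be its maximal hitting time, where $\tau_y$ is the first time $t\ge 0$ at which the walk is at $y$. The lamplighter walk on $\mathbf Z_2\wr G$ is the Markov chain on pairs $(f,x)$ with $f\colon V\to\{0,1\}$ and $x\in V$ that, from $(f,x)$, replaces $f_x$ by a uniform random bit, moves from $x$ to $y$ with probability $P(x,y)$, and then replaces the value of the lamp at $y$ by an independent uniform random bit, all other lamps being unchanged. For a reversible irreducible finite Markov chain with eigenvalues $1=\lambda_1>\lambda_2\ge\lambda_3\ge\cdots$ the relaxation time is $t_{\rm rel}=\frac1{1-\lambda_2}$; write $t_{\rm rel}(G)$ for that of $P$ and $t_{\rm rel}(\mathbf Z_2\wr G)$ for that of the lamplighter walk. There are universal constants $0<c_1\le C_1<\infty$, not depending on $G$, such that for every such $G$ the maximal hitting time $t_{\rm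 hit}(G)$ is finite and \[ c_1\, t_{\rm hit}(G)\ \le\ t_{\rm rel}(\mathbf Z_2\wr G)\ \le\ C_1\, t_{\rm hit}(G), \] and moreover \[ t_{\rm rel}(\mathbf Z_2\wr G)\ \le\ \max\Big\{\frac{4}{\log 2}\,t_{\rm hit}(G),\ 2\,t_{\rm rel}(G)\Big\}. \] -/

import Mathlib

open MeasureTheory ProbabilityTheory
open scoped ENNReal

noncomputable section

namespace Lamplighter

/-! ### Finite Markov chains: trajectories, hitting times, relaxation time -/

section Chain

variable {S : Type*} [Fintype S] [DecidableEq S]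

/-- The distribution `P(x, ·)` of the next state, given the current state `x`. -/
def stepPMF (P : Matrix S S ℝ) (hP : P ∈ Matrix.rowStochastic ℝ S) (x : S) : PMF S :=
  PMF.ofFintype (fun y => ENNReal.ofReal (P x y)) (by
    rw [← ENNReal.ofReal_sum_of_nonneg
      (fun y _ => Matrix.nonneg_of_mem_rowStochastic hP),
      Matrix.sum_row_of_mem_rowStochastic hP x, ENNReal.ofReal_one])

/-- The transition kernel from a past `(X₀, …, Xₙ)` to the next state `Xₙ₊₁`; it depends on the
past only through `Xₙ`. -/
def stepKernel [MeasurableSpace S] [DiscreteMeasurableSpace S]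
    (P : Matrix S S ℝ) (hP : P ∈ Matrix.rowStochastic ℝ S) (n : ℕ) :
    Kernel (Finset.Iic n → S) S :=
  Kernel.ofFunOfCountable fun h => (stepPMF P hP (h ⟨n, Finset.mem_Iic.2 le_rfl⟩)).toMeasure

instance stepKernel.instIsMarkovKernel [MeasurableSpace S] [DiscreteMeasurableSpace S]
    (P : Matrix S S ℝ) (hP : P ∈ Matrix.rowStochastic ℝ S) (n : ℕ) :
    IsMarkovKernel (stepKernel P hP n) :=
  ⟨fun h => PMF.toMeasure.isProbabilityMeasure
    (stepPMF P hP (h ⟨n, Finset.mem_Iic.2 le_rfl⟩))⟩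

/-- The law on trajectories of the Markov chain with transition matrix `P` started at `x`. -/
def chainLaw [MeasurableSpace S] [DiscreteMeasurableSpace S]
    (P : Matrix S S ℝ) (hP : P ∈ Matrix.rowStochastic ℝ S) (x : S) : Measure (ℕ → S) :=
  Kernel.traj (X := fun _ => S) (stepKernel P hP) 0 (fun _ => x)

/-- The first time `t ≥ 0` at which the trajectory `ω` is at `y` (`∞` if there is none). -/
def hittingTime (y : S) (ω : ℕ → S) : ℝ≥0∞ :=
  ⨅ (t : ℕ) (_ : ω t = y), (t : ℝ≥0∞)

/-- The maximal hitting time `max_{x,y} E_x[τ_y]`. -/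
def maxHittingTime (P : Matrix S S ℝ) (hP : P ∈ Matrix.rowStochastic ℝ S) : ℝ≥0∞ :=
  letI : MeasurableSpace S := ⊤
  ⨆ (x : S) (y : S), ∫⁻ ω, hittingTime y ω ∂(chainLaw P hP x)

/-- The second largest eigenvalue `λ₂` of the transition matrix of a reversible chain: the largest
eigenvalue after one copy of the top eigenvalue `1` is removed, multiplicities being counted. -/
def secondEigenvalue (P : Matrix S S ℝ) : ℝ :=
  sSup {l : ℝ | Module.End.HasEigenvalue (Matrix.toLin' P) l ∧
    (l = 1 → 2 ≤ Module.finrank ℝ (Module.End.eigenspace (Matrix.toLin' P) 1))}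

/-- The relaxation time `1 / (1 - λ₂)`. -/
def relaxationTime (P : Matrix S S ℝ) : ℝ :=
  1 / (1 - secondEigenvalue P)

end Chain

/-! ### The lazy random walk on a graph and the lamplighter walk over it -/

section Walk

variable {V : Type*} [Fintype V] [DecidableEq V]

/-- Transition matrix of the lazy simple random walk on `G`. -/
def lazyWalk (G : SimpleGraph V) [DecidableRel G.Adj] : Matrix V V ℝ := fun x y =>
  if x = y then 1 / 2 else if G.Adj x y then 1 / (2 * (G.degree x : ℝ)) else 0

theorem lazyWalk_mem_rowStochastic [Nontrivial V] (G : SimpleGraph V) [DecidableRel G.Adj]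
    (hG : G.Connected) : lazyWalk G ∈ Matrix.rowStochastic ℝ V := by
  rw [Matrix.mem_rowStochastic_iff_sum]
  refine ⟨fun x y => ?_, fun x => ?_⟩
  · unfold lazyWalk
    split_ifs <;> positivity
  · have hd : 0 < G.degree x := hG.preconnected.degree_pos_of_nontrivial x
    have hd' : (G.degree x : ℝ) ≠ 0 := by positivity
    have h : ∀ y, lazyWalk G x y =
        (if x = y then 1 / 2 else 0) + (if G.Adj x y then 1 / (2 * (G.degree x : ℝ)) else 0) := by
      intro y
      unfold lazyWalk
      by_cases hxy : x = y
      · subst hxy; simp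
      · simp [hxy]
    simp only [h, Finset.sum_add_distrib, Finset.sum_ite_eq, Finset.mem_univ, if_true]
    rw [← Finset.sum_filter, Finset.sum_const, ← SimpleGraph.neighborFinset_eq_filter,
      SimpleGraph.card_neighborFinset_eq_degree, nsmul_eq_mul]
    field_simp
    norm_num

/-- Transition matrix of the lamplighter walk on `ℤ₂ ≀ G` over a walk on `V` with transition
matrix `P`. A state is a lamp configuration together with a position. From `(f, x)` the lamp at `x`
is set to a uniform value `a`, the lamplighter moves to `y` with probability `P x y`, and the lamp
at `y` is set to an independent uniform value `b`. -/
def lamplighterWalk (P : Matrix V V ℝ) : Matrix ((V → ZMod 2) × V) ((V → ZMod 2) × V) ℝ :=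
  fun s t => P s.2 t.2 * ∑ a : ZMod 2, ∑ b : ZMod 2,
    if Function.update (Function.update s.1 s.2 a) t.2 b = t.1 then (1 / 4 : ℝ) else 0

end Walk

end Lamplighter

end

/-!
A function on the states of the lamplighter walk that is odd in the lamp at `o` is annihilated by
any step from `o`, because that lamp is refreshed there. On such functions the walk therefore acts
like the chain `P` killed on hitting `o`, and an eigenfunction that is even in every lamp is an
eigenfunction of `P`.

*Upper bound.* Suppose `g ≥ 0` vanishes at `o` and satisfies `P g ≥ l g` elsewhere. With
`h x = E_x[τ_o]`, the function `g - (1 - l) (max g) h` is subharmonic off `o` and vanishes at `o`,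
so the maximum principle yields `1 ≤ (1 - l) max h`. This applies to the supremum over the lamp
configurations of an odd eigenfunction, and to `v - min v` for an eigenfunction `v` of `P`. Every
eigenvalue `l ≠ 1` thus satisfies `l ≤ 1 - 1 / t_hit`.

*Lower bound.* The top eigenfunction of the killed chain lifts to an odd eigenfunction of the
lamplighter walk. Testing the Rayleigh quotient with `h` itself, for which `P h = h - 1` off `o`,
and applying Cauchy-Schwarz gives a spectral gap of at most `1 / E_π[τ_o]`. The random target
lemma, that `∑ y, π y * E_x[τ_y]` does not depend on `x`, combined with the triangle inequality for
mean hitting times, provides a state `o` with `t_hit ≤ 2 E_π[τ_o]`.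
-/

noncomputable section

namespace Lamplighter

open Matrix Finset

section HittingTimes

variable {S : Type*}

/-- The event `τ_y > n` that the trajectory stays away from `y` up to and including time `n`. -/
def avoids (y : S) (n : ℕ) : Set (ℕ → S) := {ω | ∀ t ≤ n, ω t ≠ y}

theorem mem_avoids_succ {y : S} {n : ℕ} {ω : ℕ → S} :
    ω ∈ avoids y (n + 1) ↔ ω ∈ avoids y n ∧ ω (n + 1) ≠ y := by
  simp only [avoids, Set.mem_ofPred_eq, Nat.le_succ_iff, or_imp, forall_and, forall_eq]

theorem measurableSet_avoids [MeasurableSpace S] [DiscreteMeasurableSpace S] (y : S) (n : ℕ) :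
    MeasurableSet (avoids y n) := by
  simp only [avoids, Set.ofPred_forall]
  exact .iInter fun t => .iInter fun _ =>
    (measurableSet_singleton y).compl.preimage (measurable_pi_apply t)

theorem hittingTime_eq_tsum_avoids (y : S) (ω : ℕ → S) :
    hittingTime y ω = ∑' n : ℕ, (avoids y n).indicator 1 ω := by
  classical
  by_cases hit : ∃ t, ω t = y
  · have hτ : hittingTime y ω = (Nat.find hit : ℝ≥0∞) :=
      le_antisymm (iInf₂_le (Nat.find hit) (Nat.find_spec hit))
        (le_iInf₂ fun t ht => Nat.cast_le.2 (Nat.find_min' hit ht))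
    have havoid : ∀ n, ω ∈ avoids y n ↔ n ∈ range (Nat.find hit) := fun n => by
      rw [mem_range, Nat.lt_find_iff]; rfl
    rw [hτ, tsum_eq_sum (s := range (Nat.find hit)) fun n hn =>
      Set.indicator_of_notMem (mt (havoid n).1 hn) _]
    simp [sum_congr rfl fun n hn => Set.indicator_of_mem ((havoid n).2 hn) (1 : (ℕ → S) → ℝ≥0∞)]
  · push Not at hit
    have havoid : ∀ n, (avoids y n).indicator (1 : (ℕ → S) → ℝ≥0∞) ω = 1 := fun n =>
      Set.indicator_of_mem (s := avoids y n) (fun t _ => hit t) _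
    simp only [hittingTime, hit, havoid, iInf_false, iInf_top]
    exact (ENNReal.tsum_const_eq_top_of_ne_zero one_ne_zero).symm

variable [Fintype S] [DecidableEq S]

/-- One step of the chain killed at `y`: `E_x[φ(X₁); X₀ ≠ y]`. -/
def killedStep (P : Matrix S S ℝ) (y : S) (φ : S → ℝ≥0∞) (x : S) : ℝ≥0∞ :=
  if x = y then 0 else ∑ z, ENNReal.ofReal (P x z) * φ z

variable [MeasurableSpace S] [DiscreteMeasurableSpace S] {P : Matrix S S ℝ}
  (hP : P ∈ rowStochastic ℝ S)

theorem lintegral_stepPMF (x : S) (φ : S → ℝ≥0∞) :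
    ∫⁻ z, φ z ∂(stepPMF P hP x).toMeasure = ∑ z, ENNReal.ofReal (P x z) * φ z := by
  rw [lintegral_fintype]
  refine sum_congr rfl fun z _ => ?_
  rw [PMF.toMeasure_apply_singleton _ _ (MeasurableSet.singleton z), mul_comm]
  rfl

theorem lintegral_chainLaw_zero (x : S) (φ : S → ℝ≥0∞) :
    ∫⁻ ω, φ (ω 0) ∂(chainLaw P hP x) = φ x := by
  let ψ : (Iic 0 → S) → ℝ≥0∞ := fun p => φ (p ⟨0, by simp⟩)
  calc ∫⁻ ω, φ (ω 0) ∂(chainLaw P hP x)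
      = ∫⁻ p, ψ p ∂((chainLaw P hP x).map (Preorder.frestrictLe (π := fun _ => S) 0)) := by
        rw [lintegral_map .of_discrete (by fun_prop)]; rfl
    _ = φ x := by
        rw [chainLaw, Kernel.traj_map_frestrictLe_apply, Kernel.partialTraj_self, Kernel.id_apply,
          lintegral_dirac' _ .of_discrete]

theorem lintegral_chainLaw_succ (x : S) (n : ℕ) (φ : (Iic n → S) → S → ℝ≥0∞) :
    ∫⁻ ω, φ (Preorder.frestrictLe n ω) (ω (n + 1)) ∂(chainLaw P hP x) =
      ∫⁻ ω, ∑ z, ENNReal.ofReal (P (ω n) z) * φ (Preorder.frestrictLe n ω) z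
        ∂(chainLaw P hP x) := by
  let past : (ℕ → S) → (Iic n → S) := Preorder.frestrictLe (π := fun _ => S) n
  let μ := (chainLaw P hP x).map past
  have hjoint : (chainLaw P hP x).map (fun ω => (past ω, ω (n + 1))) = μ ⊗ₘ stepKernel P hP n := by
    simp only [μ, past, chainLaw, Kernel.traj_map_frestrictLe_apply]
    exact (Kernel.partialTraj_compProd_eq_map_traj (X := fun _ => S) (κ := stepKernel P hP)
      n.zero_le (x₀ := fun _ => x)).symm
  have hφ : Measurable fun q : (Iic n → S) × S => φ q.1 q.2 := .of_discrete
  calc ∫⁻ ω, φ (past ω) (ω (n + 1)) ∂(chainLaw P hP x)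
      = ∫⁻ q, φ q.1 q.2 ∂(μ ⊗ₘ stepKernel P hP n) := by
        rw [← hjoint, lintegral_map hφ (by fun_prop)]
    _ = ∫⁻ p, ∫⁻ z, φ p z ∂(stepKernel P hP n p) ∂μ := Measure.lintegral_compProd hφ
    _ = ∫⁻ p, ∑ z, ENNReal.ofReal (P (p ⟨n, mem_Iic.2 le_rfl⟩) z) * φ p z ∂μ :=
        lintegral_congr fun p => lintegral_stepPMF hP _ (φ p)
    _ = _ := by rw [lintegral_map .of_discrete (by fun_prop)]; rfl

theorem setLIntegral_avoids_succ (x y : S) (n : ℕ) {φ : S → ℝ≥0∞} (hφ : φ y = 0) :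
    ∫⁻ ω in avoids y (n + 1), φ (ω (n + 1)) ∂(chainLaw P hP x) =
      ∫⁻ ω in avoids y n, killedStep P y φ (ω n) ∂(chainLaw P hP x) := by
  let A : Set (Iic n → S) := {p | ∀ t, p t ≠ y}
  have hA : ∀ ω : ℕ → S, Preorder.frestrictLe n ω ∈ A ↔ ω ∈ avoids y n := fun ω => by
    simp [A, avoids, Preorder.frestrictLe]
  classical
  rw [← lintegral_indicator (measurableSet_avoids _ _),
    ← lintegral_indicator (measurableSet_avoids _ _)]
  convert lintegral_chainLaw_succ hP x n fun p z => if p ∈ A then φ z else 0 using 3 with ω ω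
  · by_cases h : ω (n + 1) = y <;> simp [Set.indicator_apply, mem_avoids_succ, hA, h, hφ]
  · by_cases h : ω ∈ avoids y n
    · simp [h, hA, killedStep, h n le_rfl]
    · simp [h, hA]

theorem setLIntegral_avoids (x y : S) (n : ℕ) {φ : S → ℝ≥0∞} (hφ : φ y = 0) :
    ∫⁻ ω in avoids y n, φ (ω n) ∂(chainLaw P hP x) = (killedStep P y)^[n] φ x := by
  induction n generalizing φ with
  | zero =>
    rw [← lintegral_indicator (measurableSet_avoids _ _), Function.iterate_zero, id,
      ← lintegral_chainLaw_zero hP x φ]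
    refine lintegral_congr fun ω => ?_
    by_cases h : ω 0 = y <;> simp [avoids, h, hφ]
  | succ n ih =>
    rw [setLIntegral_avoids_succ hP x y n hφ, ih (if_pos rfl), Function.iterate_succ_apply]

end HittingTimes

section MeanHittingTimes

variable {V : Type*} [Fintype V] [DecidableEq V]

/-- The mean hitting time `E_x[τ_y]`, as a function of the starting point `x`. -/
def eMeanHit (P : Matrix V V ℝ) (hP : P ∈ rowStochastic ℝ V) (y x : V) : ℝ≥0∞ :=
  letI : MeasurableSpace V := ⊤
  ∫⁻ ω, hittingTime y ω ∂(chainLaw P hP x)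

/-- The mean hitting time `E_x[τ_y]` as a real number, with the junk value `0` if it is infinite,
as a function of the starting point `x`. -/
def meanHit (P : Matrix V V ℝ) (hP : P ∈ rowStochastic ℝ V) (y x : V) : ℝ :=
  (eMeanHit P hP y x).toReal

variable {P : Matrix V V ℝ} (hP : P ∈ rowStochastic ℝ V)

theorem eMeanHit_eq_tsum (y x : V) :
    eMeanHit P hP y x = ∑' n, (killedStep P y)^[n] (fun z => if z = y then 0 else 1) x := by
  let _ : MeasurableSpace V := ⊤
  simp only [eMeanHit, hittingTime_eq_tsum_avoids]
  rw [lintegral_tsum fun n => (measurable_one.indicator (measurableSet_avoids y n)).aemeasurable]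
  refine tsum_congr fun n => ?_
  rw [← setLIntegral_avoids hP x y n (if_pos rfl), lintegral_indicator (measurableSet_avoids y n)]
  refine setLIntegral_congr_fun (measurableSet_avoids y n) fun ω hω => ?_
  simp [hω n le_rfl]

theorem eMeanHit_self (y : V) : eMeanHit P hP y y = 0 := by
  rw [eMeanHit_eq_tsum, ENNReal.tsum_eq_zero]
  rintro (_ | n)
  · simp
  · rw [Function.iterate_succ_apply', killedStep, if_pos rfl]

theorem eMeanHit_of_ne {x y : V} (hxy : x ≠ y) :
    eMeanHit P hP y x = 1 + ∑ z, ENNReal.ofReal (P x z) * eMeanHit P hP y z := by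
  simp only [eMeanHit_eq_tsum]
  rw [tsum_eq_zero_add' ENNReal.summable]
  simp only [Function.iterate_zero, id, if_neg hxy, Function.iterate_succ_apply', killedStep,
    ← ENNReal.tsum_mul_left]
  rw [Summable.tsum_finsetSum fun _ _ => ENNReal.summable]

theorem eMeanHit_le_of_supersolution {y : V} {g : V → ℝ≥0∞}
    (hg : ∀ x, x ≠ y → 1 + ∑ z, ENNReal.ofReal (P x z) * g z ≤ g x) (x : V) :
    eMeanHit P hP y x ≤ g x := by
  rw [eMeanHit_eq_tsum, ENNReal.tsum_eq_iSup_nat]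
  refine iSup_le fun N => ?_
  induction N generalizing x with
  | zero => simp
  | succ N ih =>
    rw [sum_range_succ']
    by_cases hxy : x = y
    · simp [Function.iterate_succ_apply', killedStep, hxy]
    · refine le_trans ?_ (hg x hxy)
      simp only [Function.iterate_zero, id, if_neg hxy, Function.iterate_succ_apply', killedStep]
      rw [add_comm, sum_comm]
      simp only [← mul_sum]
      gcongr with z
      exact ih z

end MeanHittingTimes

section MaximumPrinciple

variable {V : Type*} [Fintype V] [DecidableEq V] {P : Matrix V V ℝ}

theorem mulVec_mono_of_mem_rowStochastic (hP : P ∈ rowStochastic ℝ V) {u w : V → ℝ}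
    (huw : u ≤ w) : P *ᵥ u ≤ P *ᵥ w := fun _ =>
  dotProduct_le_dotProduct_of_nonneg_left huw fun _ => nonneg_of_mem_rowStochastic hP

theorem mulVec_const_of_mem_rowStochastic (hP : P ∈ rowStochastic ℝ V) (c : ℝ) :
    (P *ᵥ fun _ => c) = fun _ => c := by
  ext x
  simp [mulVec, dotProduct, ← sum_mul, sum_row_of_mem_rowStochastic hP]

theorem abs_mulVec_le_of_mem_rowStochastic (hP : P ∈ rowStochastic ℝ V) (u : V → ℝ) :
    |P *ᵥ u| ≤ P *ᵥ |u| :=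
  abs_le'.2 ⟨mulVec_mono_of_mem_rowStochastic hP (le_abs_self u),
    mulVec_neg u P ▸ mulVec_mono_of_mem_rowStochastic hP (neg_le_abs u)⟩

theorem eq_of_isMax_of_le_mulVec (hP : P ∈ rowStochastic ℝ V) {u : V → ℝ} {m z : V}
    (hmax : ∀ x, u x ≤ u m) (hm : u m ≤ (P *ᵥ u) m) (hmz : 0 < P m z) : u z = u m := by
  have hnonneg : ∀ x ∈ univ, 0 ≤ P m x * (u m - u x) := fun x _ =>
    mul_nonneg (nonneg_of_mem_rowStochastic hP) (sub_nonneg.2 (hmax x))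
  have hsum : ∑ x, P m x * (u m - u x) ≤ 0 := by
    simp only [mul_sub, sum_sub_distrib, ← sum_mul, sum_row_of_mem_rowStochastic hP, one_mul]
    exact sub_nonpos.2 hm
  have hzero := (sum_eq_zero_iff_of_nonneg hnonneg).1 (hsum.antisymm (sum_nonneg hnonneg)) z
    (mem_univ z)
  exact (sub_eq_zero.1 ((mul_eq_zero.1 hzero).resolve_left hmz.ne')).symm

theorem le_of_subharmonic_off (hP : P ∈ rowStochastic ℝ V) (hirr : P.IsIrreducible) {o : V}
    {u : V → ℝ} (hu : ∀ x, x ≠ o → u x ≤ (P *ᵥ u) x) (x : V) : u x ≤ u o := by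
  obtain ⟨m, -, hmax⟩ := exists_max_image univ u ⟨o, mem_univ o⟩
  replace hmax := fun x => hmax x (mem_univ x)
  let _ : Quiver V := toQuiver P
  have hpath : ∀ {z : V}, Quiver.Path m z → u z = u m ∨ u o = u m := by
    intro z p
    induction p with
    | nil => exact .inl rfl
    | @cons a c _ hac ih =>
      refine ih.elim (fun ha => ?_) .inr
      rcases eq_or_ne a o with rfl | hao
      · exact .inr ha
      · have hc := eq_of_isMax_of_le_mulVec hP (fun x => ha ▸ hmax x) (hu a hao) hac.down
        exact .inl (hc.trans ha)
  obtain ⟨p, -⟩ := hirr.connected m o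
  exact (hmax x).trans_eq ((or_self_iff.1 (hpath p)).symm)

theorem le_of_superharmonic_off (hP : P ∈ rowStochastic ℝ V) (hirr : P.IsIrreducible) {o : V}
    {u : V → ℝ} (hu : ∀ x, x ≠ o → (P *ᵥ u) x ≤ u x) (x : V) : u o ≤ u x :=
  neg_le_neg_iff.1 <| le_of_subharmonic_off hP hirr (u := -u) (o := o)
    (fun z hz => by simpa [mulVec_neg] using hu z hz) x

theorem eq_of_harmonic (hP : P ∈ rowStochastic ℝ V) (hirr : P.IsIrreducible) {u : V → ℝ}
    (hu : P *ᵥ u = u) (x y : V) : u x = u y :=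
  le_antisymm (le_of_subharmonic_off hP hirr (fun z _ => (congrFun hu z).ge) x)
    (le_of_subharmonic_off hP hirr (fun z _ => (congrFun hu z).ge) y)

theorem isUnit_one_sub_updateRow_zero (hP : P ∈ rowStochastic ℝ V) (hirr : P.IsIrreducible)
    (y : V) : IsUnit (1 - P.updateRow y 0) := by
  rw [← mulVec_injective_iff_isUnit, ← coe_mulVecLin, injective_iff_map_eq_zero]
  intro u hu
  have hy : u y = 0 := by simpa [sub_mulVec, updateRow_mulVec] using congrFun hu y
  have hx : ∀ x, x ≠ y → (P *ᵥ u) x = u x := fun x hx => by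
    simpa [sub_mulVec, updateRow_mulVec, hx, sub_eq_zero, eq_comm] using congrFun hu x
  exact funext fun x => le_antisymm
    ((le_of_subharmonic_off hP hirr (fun z hz => (hx z hz).ge) x).trans_eq hy)
    (hy.ge.trans (le_of_superharmonic_off hP hirr (fun z hz => (hx z hz).le) x))

theorem exists_firstStep_solution (hP : P ∈ rowStochastic ℝ V) (hirr : P.IsIrreducible) (y : V) :
    ∃ g : V → ℝ, (∀ x, 0 ≤ g x) ∧ ∀ x, x ≠ y → g x = 1 + (P *ᵥ g) x := by
  obtain ⟨g, hg⟩ := mulVec_surjective_iff_isUnit.2 (isUnit_one_sub_updateRow_zero hP hirr y)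
    (Function.update 1 y 0)
  have hy : g y = 0 := by simpa [sub_mulVec, updateRow_mulVec] using congrFun hg y
  have hx : ∀ x, x ≠ y → g x = 1 + (P *ᵥ g) x := fun x hx => by
    rw [← sub_eq_iff_eq_add]
    simpa [sub_mulVec, updateRow_mulVec, hx] using congrFun hg x
  refine ⟨g, fun x => hy.ge.trans (le_of_superharmonic_off hP hirr (fun z hz => ?_) x), hx⟩
  linarith [hx z hz]

end MaximumPrinciple

section FirstStepEquations

variable {V : Type*} [Fintype V] [DecidableEq V] {P : Matrix V V ℝ}
  (hP : P ∈ rowStochastic ℝ V)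

theorem meanHit_nonneg (y x : V) : 0 ≤ meanHit P hP y x := ENNReal.toReal_nonneg

theorem meanHit_self (y : V) : meanHit P hP y y = 0 := by
  rw [meanHit, eMeanHit_self, ENNReal.toReal_zero]

theorem eMeanHit_ne_top (hirr : P.IsIrreducible) (y x : V) : eMeanHit P hP y x ≠ ⊤ := by
  obtain ⟨g, hg, hsol⟩ := exists_firstStep_solution hP hirr y
  refine ne_top_of_le_ne_top ENNReal.ofReal_ne_top
    (eMeanHit_le_of_supersolution hP (g := fun x => ENNReal.ofReal (g x)) (fun x hx => ?_) x)
  have hPg : ∀ z, 0 ≤ P x z * g z := fun z =>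
    mul_nonneg (nonneg_of_mem_rowStochastic hP) (hg z)
  rw [hsol x hx, mulVec, dotProduct, ENNReal.ofReal_add zero_le_one (sum_nonneg fun z _ => hPg z),
    ENNReal.ofReal_one, ENNReal.ofReal_sum_of_nonneg fun z _ => hPg z]
  simp only [ENNReal.ofReal_mul (nonneg_of_mem_rowStochastic hP), le_refl]

theorem meanHit_of_ne (hirr : P.IsIrreducible) {x y : V} (hxy : x ≠ y) :
    meanHit P hP y x = 1 + (P *ᵥ meanHit P hP y) x := by
  have hfin : ∀ z ∈ univ, ENNReal.ofReal (P x z) * eMeanHit P hP y z ≠ ⊤ := fun z _ =>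
    ENNReal.mul_ne_top ENNReal.ofReal_ne_top (eMeanHit_ne_top hP hirr y z)
  rw [meanHit, eMeanHit_of_ne hP hxy, ENNReal.toReal_add ENNReal.one_ne_top
    (ENNReal.sum_ne_top.2 hfin), ENNReal.toReal_sum hfin]
  simp [mulVec, dotProduct, meanHit, ENNReal.toReal_ofReal (nonneg_of_mem_rowStochastic hP)]

theorem mulVec_meanHit_nonneg (y x : V) : 0 ≤ (P *ᵥ meanHit P hP y) x :=
  nonneg_mulVec_of_mem_rowStochastic hP (meanHit_nonneg hP y) x

theorem one_le_meanHit (hirr : P.IsIrreducible) {x y : V} (hxy : x ≠ y) :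
    1 ≤ meanHit P hP y x := by
  linarith [meanHit_of_ne hP hirr hxy, mulVec_meanHit_nonneg hP y x]

theorem meanHit_le_one_add_mulVec (hirr : P.IsIrreducible) (y x : V) :
    meanHit P hP y x ≤ 1 + (P *ᵥ meanHit P hP y) x := by
  rcases eq_or_ne x y with rfl | hxy
  · linarith [meanHit_self hP x, mulVec_meanHit_nonneg hP x x]
  · exact (meanHit_of_ne hP hirr hxy).le

theorem meanHit_triangle (hirr : P.IsIrreducible) (x y z : V) :
    meanHit P hP z x ≤ meanHit P hP y x + meanHit P hP z y := by
  have hsub := le_of_subharmonic_off hP hirr (u := meanHit P hP z - meanHit P hP y) (o := y)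
    (fun w hw => by
      simp only [mulVec_sub, Pi.sub_apply]
      linarith [meanHit_le_one_add_mulVec hP hirr z w, meanHit_of_ne hP hirr hw]) x
  simp only [Pi.sub_apply, meanHit_self] at hsub
  linarith

theorem maxHittingTime_ne_top (hirr : P.IsIrreducible) : maxHittingTime P hP ≠ ⊤ := by
  have hsum : ∑ x, ∑ y, eMeanHit P hP y x ≠ ⊤ := ENNReal.sum_ne_top.2 fun x _ =>
    ENNReal.sum_ne_top.2 fun y _ => eMeanHit_ne_top hP hirr y x
  exact ne_top_of_le_ne_top hsum <| iSup₂_le fun x y =>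
    (single_le_sum_of_canonicallyOrdered (f := fun y => eMeanHit P hP y x) (mem_univ y)).trans
      (single_le_sum_of_canonicallyOrdered (f := fun x => ∑ y, eMeanHit P hP y x) (mem_univ x))

theorem meanHit_le_maxHittingTime (hirr : P.IsIrreducible) (y x : V) :
    meanHit P hP y x ≤ (maxHittingTime P hP).toReal :=
  ENNReal.toReal_mono (maxHittingTime_ne_top hP hirr)
    (le_iSup₂ (f := fun x y => eMeanHit P hP y x) x y)

theorem maxHittingTime_le (hirr : P.IsIrreducible) {c : ℝ} (hc : 0 ≤ c)
    (h : ∀ x y, meanHit P hP y x ≤ c) : (maxHittingTime P hP).toReal ≤ c :=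
  ENNReal.toReal_le_of_le_ofReal hc <| iSup₂_le fun x y =>
    (ENNReal.le_ofReal_iff_toReal_le (eMeanHit_ne_top hP hirr y x) hc).2 (h x y)

theorem one_le_maxHittingTime [Nontrivial V] (hirr : P.IsIrreducible) :
    1 ≤ (maxHittingTime P hP).toReal := by
  obtain ⟨x, y, hxy⟩ := exists_pair_ne V
  exact (one_le_meanHit hP hirr hxy).trans (meanHit_le_maxHittingTime hP hirr y x)

end FirstStepEquations

section Stationarity

variable {V : Type*} [Fintype V] [DecidableEq V] {P : Matrix V V ℝ}
  (hP : P ∈ rowStochastic ℝ V) {π : V → ℝ}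

theorem meanHit_eq_sub_single (hirr : P.IsIrreducible) (y : V) :
    meanHit P hP y =
      1 + P *ᵥ meanHit P hP y - Pi.single y (1 + (P *ᵥ meanHit P hP y) y) := by
  ext x
  rcases eq_or_ne x y with rfl | hxy
  · simp [meanHit_self]
  · simp [hxy, meanHit_of_ne hP hirr hxy]

theorem mul_meanReturn_eq_sum (hirr : P.IsIrreducible) (hstat : π ᵥ* P = π) (y : V) :
    π y * (1 + (P *ᵥ meanHit P hP y) y) = ∑ x, π x := by
  have h := congrArg (π ⬝ᵥ ·) (meanHit_eq_sub_single hP hirr y)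
  simp only [dotProduct_sub, dotProduct_add, dotProduct_one, dotProduct_single,
    dotProduct_mulVec, hstat] at h
  linarith

theorem sum_smul_meanHit_harmonic (hirr : P.IsIrreducible) (hstat : π ᵥ* P = π) :
    P *ᵥ (∑ y, π y • meanHit P hP y) = ∑ y, π y • meanHit P hP y := by
  ext x
  have hstep : ∀ y, π y * (P *ᵥ meanHit P hP y) x =
      π y * meanHit P hP y x - π y + if x = y then ∑ z, π z else 0 := fun y => by
    have h := congrFun (meanHit_eq_sub_single hP hirr y) x
    simp only [Pi.sub_apply, Pi.add_apply, Pi.one_apply, Pi.single_apply] at h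
    rw [h]
    split_ifs
    · linarith [mul_meanReturn_eq_sum hP hirr hstat y]
    · ring
  simp [mulVec_sum, mulVec_smul, hstep, sum_add_distrib]

theorem sum_mul_meanHit_eq (hirr : P.IsIrreducible) (hstat : π ᵥ* P = π) (x x' : V) :
    ∑ y, π y * meanHit P hP y x = ∑ y, π y * meanHit P hP y x' := by
  simpa using eq_of_harmonic hP hirr (sum_smul_meanHit_harmonic hP hirr hstat) x x'

theorem sum_mul_sum_mul_meanHit_eq (hirr : P.IsIrreducible) (hstat : π ᵥ* P = π) (x : V) :
    (∑ z, π z) * ∑ y, π y * meanHit P hP y x = ∑ y, π y * (π ⬝ᵥ meanHit P hP y) := by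
  calc (∑ z, π z) * ∑ y, π y * meanHit P hP y x
      = ∑ z, π z * ∑ y, π y * meanHit P hP y z := by
        rw [sum_mul]
        exact sum_congr rfl fun z _ => by rw [sum_mul_meanHit_eq hP hirr hstat x z]
    _ = ∑ y, π y * (π ⬝ᵥ meanHit P hP y) := by
        simp only [dotProduct, mul_sum]
        rw [sum_comm]
        exact sum_congr rfl fun y _ => sum_congr rfl fun z _ => mul_left_comm _ _ _

theorem exists_sum_mul_maxHittingTime_le [Nonempty V] (hirr : P.IsIrreducible)
    (hπ : ∀ x, 0 < π x) (hstat : π ᵥ* P = π) :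
    ∃ o, (∑ x, π x) * (maxHittingTime P hP).toReal ≤ 2 * (π ⬝ᵥ meanHit P hP o) := by
  have hsum : 0 < ∑ x, π x := sum_pos (fun x _ => hπ x) univ_nonempty
  obtain ⟨o, -, hmax⟩ := exists_max_image univ (fun y => π ⬝ᵥ meanHit P hP y) univ_nonempty
  replace hmax := fun y => hmax y (mem_univ y)
  have hnonneg : 0 ≤ π ⬝ᵥ meanHit P hP o :=
    dotProduct_nonneg_of_nonneg (fun x => (hπ x).le) (meanHit_nonneg hP o)
  have htarget : ∀ x, ∑ y, π y * meanHit P hP y x ≤ π ⬝ᵥ meanHit P hP o := fun x => by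
    refine le_of_mul_le_mul_left ?_ hsum
    rw [sum_mul_sum_mul_meanHit_eq hP hirr hstat, sum_mul]
    gcongr with y
    · exact (hπ y).le
    · exact hmax y
  have hpair : ∀ x y, meanHit P hP y x ≤ 2 * (π ⬝ᵥ meanHit P hP o) / ∑ z, π z := fun x y => by
    rw [le_div_iff₀' hsum]
    -- Travel from `x` to `y` through a state `z` drawn from `π`.
    calc (∑ z, π z) * meanHit P hP y x
        ≤ ∑ z, π z * (meanHit P hP z x + meanHit P hP y z) := by
          rw [sum_mul]
          gcongr with z
          · exact (hπ z).le
          · exact meanHit_triangle hP hirr x z y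
      _ = ∑ z, π z * meanHit P hP z x + π ⬝ᵥ meanHit P hP y := by
          simp only [mul_add, sum_add_distrib, dotProduct]
      _ ≤ 2 * (π ⬝ᵥ meanHit P hP o) := by linarith [htarget x, hmax y]
  exact ⟨o, (le_div_iff₀' hsum).1 (maxHittingTime_le hP hirr (by positivity) hpair)⟩

end Stationarity

section SpectralBounds

variable {V : Type*} [Fintype V] [DecidableEq V] {P : Matrix V V ℝ}
  (hP : P ∈ rowStochastic ℝ V) {l : ℝ}

theorem le_one_sub_inv_maxHittingTime_of_subeigenfunction (hirr : P.IsIrreducible) {o : V}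
    {g : V → ℝ} (hg0 : 0 ≤ g) (hne : g ≠ 0) (ho : g o = 0)
    (hg : ∀ x, x ≠ o → l * g x ≤ (P *ᵥ g) x) : l ≤ 1 - (maxHittingTime P hP).toReal⁻¹ := by
  set T := (maxHittingTime P hP).toReal
  obtain ⟨m, -, hmax⟩ := exists_max_image univ g ⟨o, mem_univ o⟩
  have hm : 0 < g m := by
    by_contra! hm
    exact hne (funext fun x => ((hmax x (mem_univ x)).trans hm).antisymm (hg0 x))
  set c := max (1 - l) 0
  have hsub : g m ≤ c * g m * meanHit P hP o m := by
    have := le_of_subharmonic_off hP hirr (u := g - (c * g m) • meanHit P hP o) (o := o)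
      (fun x hx => by
        have hstep : (1 - l) * g x ≤ c * g m := mul_le_mul (le_max_left _ _)
          (hmax x (mem_univ x)) (hg0 x) (le_max_right _ _)
        simp only [mulVec_sub, mulVec_smul, Pi.sub_apply, Pi.smul_apply, smul_eq_mul]
        linarith [hg x hx, congrArg (c * g m * ·) (meanHit_of_ne hP hirr hx)]) m
    simpa [ho, meanHit_self] using this
  have hcT : 1 ≤ c * T := by
    refine le_of_mul_le_mul_right ?_ hm
    calc 1 * g m ≤ c * g m * meanHit P hP o m := by rwa [one_mul]
      _ ≤ c * g m * T := by
        gcongr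
        exact meanHit_le_maxHittingTime hP hirr o m
      _ = c * T * g m := by ring
  have hT : 0 < T := pos_of_mul_pos_right (zero_lt_one.trans_le hcT) (le_max_right _ _)
  have hc : T⁻¹ ≤ c := (inv_le_iff_one_le_mul₀ hT).2 hcT
  rcases le_max_iff.1 hc with hl | hl
  · linarith
  · exact absurd (inv_pos.2 hT) hl.not_gt

theorem eigenvalue_le_one (hP : P ∈ rowStochastic ℝ V) {v : V → ℝ} (hv : v ≠ 0)
    (heig : P *ᵥ v = l • v) : l ≤ 1 := by
  obtain ⟨z, hz⟩ := Function.ne_iff.1 hv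
  obtain ⟨m, -, hmax⟩ := exists_max_image univ |v| ⟨z, mem_univ z⟩
  have hm : 0 < |v| m := (abs_pos.2 hz).trans_le (hmax z (mem_univ z))
  refine le_of_mul_le_mul_right ?_ hm
  calc l * |v| m ≤ |P *ᵥ v| m := by
        rw [heig]
        simpa [abs_mul] using mul_le_mul_of_nonneg_right (le_abs_self l) hm.le
    _ ≤ (P *ᵥ |v|) m := abs_mulVec_le_of_mem_rowStochastic hP v m
    _ ≤ (P *ᵥ fun _ => |v| m) m :=
        mulVec_mono_of_mem_rowStochastic hP (fun x => hmax x (mem_univ x)) m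
    _ = 1 * |v| m := by rw [mulVec_const_of_mem_rowStochastic hP, one_mul]

theorem eigenvalue_le_one_sub_inv_maxHittingTime (hirr : P.IsIrreducible) {π : V → ℝ}
    (hπ : ∀ x, 0 < π x) (hstat : π ᵥ* P = π) {v : V → ℝ} (hv : v ≠ 0)
    (heig : P *ᵥ v = l • v) (hl : l ≠ 1) : l ≤ 1 - (maxHittingTime P hP).toReal⁻¹ := by
  have : Nonempty V := ⟨(Function.ne_iff.1 hv).choose⟩
  obtain ⟨o, -, hmin⟩ := exists_min_image univ v univ_nonempty
  replace hmin := fun x => hmin x (mem_univ x)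
  have horth : π ⬝ᵥ v = 0 := by
    have h : π ⬝ᵥ P *ᵥ v = π ⬝ᵥ v := by rw [dotProduct_mulVec, hstat]
    rw [heig, dotProduct_smul, smul_eq_mul] at h
    exact (mul_left_eq_self₀.1 h).resolve_left hl
  have ho : v o ≤ 0 := by
    by_contra! ho
    exact horth.not_gt (sum_pos (fun x _ => mul_pos (hπ x) (ho.trans_le (hmin x))) univ_nonempty)
  have hPg : P *ᵥ (v - fun _ => v o) = l • v - fun _ => v o := by
    rw [mulVec_sub, heig, mulVec_const_of_mem_rowStochastic hP]
  refine le_one_sub_inv_maxHittingTime_of_subeigenfunction hP hirr (g := v - fun _ => v o)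
    (o := o) (fun x => sub_nonneg.2 (hmin x)) (fun hconst => ?_) (sub_self _) fun x _ => ?_
  · replace hconst : v = fun _ => v o := sub_eq_zero.1 hconst
    have hvo : v o ≠ 0 := fun h => hv (by rw [hconst, h]; rfl)
    rw [hconst, mulVec_const_of_mem_rowStochastic hP] at heig
    exact hl (mul_right_cancel₀ hvo ((congrFun heig o).symm.trans (one_mul _).symm))
  · have hl1 := eigenvalue_le_one hP hv heig
    rw [hPg]
    simp only [Pi.sub_apply, Pi.smul_apply, smul_eq_mul]
    nlinarith

end SpectralBounds

section Reversibility

/-- The detailed balance equations: the transition matrix `P` is reversible with respect to the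
weights `π`, which need not be normalized to sum to `1`. -/
def IsReversible {ι : Type*} (π : ι → ℝ) (P : Matrix ι ι ℝ) : Prop :=
  ∀ x y, π x * P x y = π y * P y x

theorem exists_eigenvector_ge_rayleigh_of_isHermitian {ι : Type*} [Fintype ι]
    {A : Matrix ι ι ℝ} (hA : A.IsHermitian) {w : ι → ℝ} (hw : w ≠ 0) :
    ∃ (μ : ℝ) (v : ι → ℝ), v ≠ 0 ∧ A *ᵥ v = μ • v ∧ w ⬝ᵥ A *ᵥ w ≤ μ * (w ⬝ᵥ w) := by
  classical
  let T := A.toEuclideanLin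
  have hT : T.IsSymmetric := isSymmetric_toEuclideanLin_iff.2 hA
  let w' : EuclideanSpace ℝ ι := WithLp.toLp 2 w
  have hw' : w' ≠ 0 := fun h => hw (congrArg WithLp.ofLp h)
  have : Nontrivial (EuclideanSpace ℝ ι) := ⟨w', 0, hw'⟩
  obtain ⟨v, hv⟩ := hT.hasEigenvalue_iSup_of_finiteDimensional.exists_hasEigenvector
  refine ⟨_, v.ofLp, fun h => hv.2 (WithLp.ofLp_injective 2 h),
    congrArg WithLp.ofLp hv.apply_eq_smul, ?_⟩
  have hbdd : BddAbove (Set.range fun x : {x : EuclideanSpace ℝ ι // x ≠ 0} =>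
      RCLike.re (inner ℝ (T x) (x : EuclideanSpace ℝ ι)) / ‖(x : EuclideanSpace ℝ ι)‖ ^ 2) := by
    obtain ⟨c, hc⟩ := T.toContinuousLinearMap.bddAbove_rayleighQuotient
    refine ⟨c, ?_⟩
    rintro _ ⟨x, rfl⟩
    exact (le_abs_self _).trans (hc ⟨x.1, rfl⟩)
  have hle := le_ciSup hbdd ⟨w', hw'⟩
  rw [div_le_iff₀ (by positivity), EuclideanSpace.norm_sq_eq] at hle
  simpa [EuclideanSpace.inner_eq_star_dotProduct, dotProduct, sq, T, w'] using hle

variable {V : Type*} [Fintype V] {P : Matrix V V ℝ} {π : V → ℝ}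

theorem IsReversible.vecMul_eq [DecidableEq V] (hrev : IsReversible π P)
    (hP : P ∈ rowStochastic ℝ V) : π ᵥ* P = π := by
  ext y
  simp only [vecMul, dotProduct, hrev _ y, ← mul_sum, sum_row_of_mem_rowStochastic hP, mul_one]

theorem IsReversible.exists_eigenvector_ge_rayleigh (hrev : IsReversible π P)
    (hπ : ∀ x, 0 < π x) {w : V → ℝ} (hw : w ≠ 0) :
    ∃ (μ : ℝ) (v : V → ℝ), v ≠ 0 ∧ P *ᵥ v = μ • v ∧
      ∑ x, π x * (w x * (P *ᵥ w) x) ≤ μ * ∑ x, π x * w x ^ 2 := by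
  classical
  have hsqrt : ∀ x, 0 < √(π x) := fun x => Real.sqrt_pos.2 (hπ x)
  have hsq : ∀ x, √(π x) * √(π x) = π x := fun x => Real.mul_self_sqrt (hπ x).le
  let A : Matrix V V ℝ := of fun x y => √(π x) * P x y / √(π y)
  have hA : A.IsHermitian := by
    ext x y
    simp only [conjTranspose_apply, A, of_apply, star_trivial]
    rw [div_eq_div_iff (hsqrt x).ne' (hsqrt y).ne']
    linear_combination P y x * hsq y - P x y * hsq x - hrev x y
  have hconj : ∀ (u : V → ℝ) (x : V),
      (A *ᵥ fun z => √(π z) * u z) x = √(π x) * (P *ᵥ u) x := fun u x => by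
    simp only [mulVec, dotProduct, A, of_apply, mul_sum]
    refine sum_congr rfl fun z _ => ?_
    field_simp [(hsqrt z).ne']
  obtain ⟨μ, v, hv, heig, hle⟩ := exists_eigenvector_ge_rayleigh_of_isHermitian hA
    (w := fun z => √(π z) * w z)
    (fun h => hw (funext fun x => (mul_eq_zero.1 (congrFun h x)).resolve_left (hsqrt x).ne'))
  obtain ⟨u, rfl⟩ : ∃ u : V → ℝ, v = fun z => √(π z) * u z :=
    ⟨fun z => v z / √(π z), funext fun z => (mul_div_cancel₀ _ (hsqrt z).ne').symm⟩
  refine ⟨μ, u, fun h => hv (by simp [h, ← Pi.zero_def]), ?_, ?_⟩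
  · ext x
    refine mul_left_cancel₀ (hsqrt x).ne' ?_
    rw [← hconj, heig]
    exact mul_left_comm _ _ _
  · have hmul : ∀ x a b, √(π x) * a * (√(π x) * b) = π x * (a * b) := fun x a b => by
      rw [mul_mul_mul_comm, hsq]
    simpa only [dotProduct, hconj, hmul, ← sq] using hle

/-- `v` is an eigenfunction, with eigenvalue `μ`, of the chain `P` killed on hitting `o`: it
vanishes at `o` and satisfies the eigenvalue equation at all other states. -/
structure IsDirichletEigenfunction (P : Matrix V V ℝ) (o : V) (μ : ℝ) (v : V → ℝ) : Prop where
  ne_zero : v ≠ 0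
  apply_self : v o = 0
  mulVec_apply : ∀ x, x ≠ o → (P *ᵥ v) x = μ * v x

theorem IsReversible.exists_isDirichletEigenfunction (hrev : IsReversible π P)
    (hπ : ∀ x, 0 < π x) {o : V} {w : V → ℝ} (hw : w ≠ 0) (hwo : w o = 0) :
    ∃ μ v, IsDirichletEigenfunction P o μ v ∧
      ∑ x, π x * (w x * (P *ᵥ w) x) ≤ μ * ∑ x, π x * w x ^ 2 := by
  classical
  let Q : Matrix {x // x ≠ o} {x // x ≠ o} ℝ := P.submatrix (↑) (↑)
  have hrevQ : IsReversible (fun x : {x // x ≠ o} => π x) Q := fun x y => hrev x y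
  have hQ : ∀ (u : V → ℝ) (x : {x // x ≠ o}), u o = 0 → (P *ᵥ u) x = (Q *ᵥ fun z => u z) x :=
    fun u x huo => by
      simp [mulVec, dotProduct, Fintype.sum_eq_add_sum_subtype_ne _ o, huo, Q]
  obtain ⟨μ, v, hv, heig, hle⟩ := hrevQ.exists_eigenvector_ge_rayleigh (fun x => hπ x)
    (w := fun z => w z) (fun h => hw (funext fun x => by
      by_cases hx : x = o
      · exact hx ▸ hwo
      · exact congrFun h ⟨x, hx⟩))
  let v' : V → ℝ := fun x => if hx : x = o then 0 else v ⟨x, hx⟩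
  have hv'o : v' o = 0 := dif_pos rfl
  have hv' : (fun z : {x // x ≠ o} => v' z) = v := funext fun z => dif_neg z.2
  refine ⟨μ, v', ⟨fun h => hv (hv' ▸ ?_), hv'o, fun x hx => ?_⟩, ?_⟩
  · simp [h]; rfl
  · rw [hQ v' ⟨x, hx⟩ hv'o, hv', heig, ← hv']
    rfl
  · simpa [Fintype.sum_eq_add_sum_subtype_ne _ o, hwo, hQ w] using hle

end Reversibility

section DirichletEigenvalue

variable {V : Type*} [Fintype V] [DecidableEq V] {P : Matrix V V ℝ}
  (hP : P ∈ rowStochastic ℝ V)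

theorem IsDirichletEigenfunction.le_one_sub_inv_maxHittingTime (hirr : P.IsIrreducible) {o : V}
    {μ : ℝ} {v : V → ℝ} (hv : IsDirichletEigenfunction P o μ v) :
    μ ≤ 1 - (maxHittingTime P hP).toReal⁻¹ := by
  refine le_one_sub_inv_maxHittingTime_of_subeigenfunction hP hirr (abs_nonneg v)
    (fun h => hv.ne_zero (funext fun x => abs_eq_zero.1 (congrFun h x)))
    (abs_eq_zero.2 hv.apply_self) fun x hx => ?_
  calc μ * |v| x ≤ |(P *ᵥ v) x| := by
        rw [hv.mulVec_apply x hx, abs_mul]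
        exact mul_le_mul_of_nonneg_right (le_abs_self μ) (abs_nonneg _)
    _ ≤ (P *ᵥ |v|) x := abs_mulVec_le_of_mem_rowStochastic hP v x

variable [Nontrivial V]

theorem IsDirichletEigenfunction.lt_one (hP : P ∈ rowStochastic ℝ V) (hirr : P.IsIrreducible)
    {o : V} {μ : ℝ} {v : V → ℝ} (hv : IsDirichletEigenfunction P o μ v) : μ < 1 :=
  (hv.le_one_sub_inv_maxHittingTime hP hirr).trans_lt <| sub_lt_self _ <|
    inv_pos.2 (zero_lt_one.trans_le (one_le_maxHittingTime hP hirr))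

variable {π : V → ℝ}

theorem IsReversible.exists_one_sub_mul_dotProduct_meanHit_le (hrev : IsReversible π P)
    (hirr : P.IsIrreducible) (hπ : ∀ x, 0 < π x) (o : V) :
    ∃ μ v, IsDirichletEigenfunction P o μ v ∧
      (1 - μ) * (π ⬝ᵥ meanHit P hP o) ≤ ∑ x, π x := by
  set h := meanHit P hP o
  obtain ⟨x, hxo⟩ := exists_ne o
  have hx : 0 < h x := zero_lt_one.trans_le (one_le_meanHit hP hirr hxo)
  obtain ⟨μ, v, hv, hrayleigh⟩ := hrev.exists_isDirichletEigenfunction hπ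
    (fun h0 => hx.ne' (congrFun h0 x)) (meanHit_self hP o)
  refine ⟨μ, v, hv, ?_⟩
  have hpos : 0 < π ⬝ᵥ h := sum_pos' (fun z _ => mul_nonneg (hπ z).le (meanHit_nonneg hP o z))
    ⟨x, mem_univ x, mul_pos (hπ x) hx⟩
  have henergy : ∑ z, π z * (h z * (P *ᵥ h) z) = ∑ z, π z * h z ^ 2 - π ⬝ᵥ h := by
    rw [dotProduct, ← sum_sub_distrib]
    refine sum_congr rfl fun z _ => ?_
    rcases eq_or_ne z o with rfl | hzo
    · simp [h, meanHit_self]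
    · linear_combination (-π z * h z) * meanHit_of_ne hP hirr hzo
  have hcauchy : (π ⬝ᵥ h) ^ 2 ≤ (∑ z, π z) * ∑ z, π z * h z ^ 2 :=
    sum_sq_le_sum_mul_sum_of_sq_le_mul univ (fun z _ => (hπ z).le)
      (fun z _ => mul_nonneg (hπ z).le (sq_nonneg _)) fun z _ => le_of_eq (by ring)
  have hsum : 0 ≤ ∑ z, π z := sum_nonneg fun z _ => (hπ z).le
  refine le_of_mul_le_mul_right ?_ hpos
  calc (1 - μ) * (π ⬝ᵥ h) * (π ⬝ᵥ h) = (1 - μ) * (π ⬝ᵥ h) ^ 2 := by ring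
    _ ≤ (1 - μ) * ((∑ z, π z) * ∑ z, π z * h z ^ 2) :=
        mul_le_mul_of_nonneg_left hcauchy (sub_pos.2 (hv.lt_one hP hirr)).le
    _ = (∑ z, π z) * ((1 - μ) * ∑ z, π z * h z ^ 2) := by ring
    _ ≤ (∑ z, π z) * (π ⬝ᵥ h) := mul_le_mul_of_nonneg_left (by linarith) hsum

theorem IsReversible.exists_one_sub_mul_maxHittingTime_le (hrev : IsReversible π P)
    (hirr : P.IsIrreducible) (hπ : ∀ x, 0 < π x) :
    ∃ o μ v, IsDirichletEigenfunction P o μ v ∧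
      (1 - μ) * (maxHittingTime P hP).toReal ≤ 2 := by
  obtain ⟨o, ho⟩ := exists_sum_mul_maxHittingTime_le hP hirr hπ (hrev.vecMul_eq hP)
  obtain ⟨μ, v, hv, hμ⟩ := hrev.exists_one_sub_mul_dotProduct_meanHit_le hP hirr hπ o
  refine ⟨o, μ, v, hv, le_of_mul_le_mul_left ?_ (sum_pos (fun x _ => hπ x) univ_nonempty)⟩
  calc (∑ x, π x) * ((1 - μ) * (maxHittingTime P hP).toReal)
      = (1 - μ) * ((∑ x, π x) * (maxHittingTime P hP).toReal) := by ring
    _ ≤ (1 - μ) * (2 * (π ⬝ᵥ meanHit P hP o)) :=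
        mul_le_mul_of_nonneg_left ho (sub_pos.2 (hv.lt_one hP hirr)).le
    _ ≤ (∑ x, π x) * 2 := by linarith

end DirichletEigenvalue

section Lamps

variable {V : Type*} [DecidableEq V]

/-- The involution of the states of the lamplighter walk that switches the lamp at `o`. -/
def lampFlip (o : V) (s : (V → ZMod 2) × V) : (V → ZMod 2) × V :=
  (s.1 + Pi.single o 1, s.2)

theorem lampFlip_involutive (o : V) : Function.Involutive (lampFlip o) := fun s => by
  simp [lampFlip, add_assoc, ← Pi.single_add, CharTwo.add_self_eq_zero]

/-- The antisymmetrization of `F` with respect to the lamp at `o`. -/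
def lampDiff (o : V) (F : (V → ZMod 2) × V → ℝ) : (V → ZMod 2) × V → ℝ :=
  F - F ∘ lampFlip o

theorem lampDiff_comp_lampFlip (o : V) (F : (V → ZMod 2) × V → ℝ) :
    lampDiff o F ∘ lampFlip o = -lampDiff o F := by
  ext s
  simp [lampDiff, lampFlip_involutive o s]

theorem eq_comp_snd_of_comp_lampFlip_eq [Finite V] {F : (V → ZMod 2) × V → ℝ}
    (hF : ∀ o, F ∘ lampFlip o = F) : F = (fun x => F (0, x)) ∘ Prod.snd := by
  have := Fintype.ofFinite V
  ext ⟨f, x⟩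
  have hpartial : ∀ A : Finset V, F (∑ z ∈ A, Pi.single z (f z), x) = F (0, x) := fun A => by
    induction A using Finset.induction_on with
    | empty => rw [sum_empty]
    | insert o A ho ih =>
      rw [sum_insert ho, add_comm, ← ih]
      obtain h | h : f o = 0 ∨ f o = 1 := Fin.exists_fin_two.1 ⟨_, rfl⟩
      · rw [h, Pi.single_zero, add_zero]
      · rw [h]
        exact congrFun (hF o) (_, x)
  simpa [univ_sum_single] using hpartial univ

/-- The lift of a function `v` of the position to a function of the states of the lamplighter
walk that changes sign with the lamp at `o`. -/
def lampLift (o : V) (v : V → ℝ) (s : (V → ZMod 2) × V) : ℝ :=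
  if s.1 o = 0 then v s.2 else -v s.2

theorem lampLift_comp_lampFlip (o : V) (v : V → ℝ) :
    lampLift o v ∘ lampFlip o = -lampLift o v := by
  ext s
  obtain h | h : s.1 o = 0 ∨ s.1 o = 1 := Fin.exists_fin_two.1 ⟨_, rfl⟩ <;>
    simp [lampLift, lampFlip, h, CharTwo.add_self_eq_zero]

end Lamps

section LamplighterWalk

variable {V : Type*} [Fintype V] [DecidableEq V]

theorem lamplighterWalk_apply (P : Matrix V V ℝ) (s t : (V → ZMod 2) × V) :
    lamplighterWalk P s t = if ∀ z, z ≠ s.2 → z ≠ t.2 → s.1 z = t.1 z then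
      P s.2 t.2 * (if s.2 = t.2 then 1 / 2 else 1 / 4) else 0 := by
  obtain ⟨f, x⟩ := s
  obtain ⟨g, y⟩ := t
  have hlast : ∀ u : V → ZMod 2, (∑ b, if Function.update u y b = g then (1 / 4 : ℝ) else 0) =
      if ∀ z, z ≠ y → u z = g z then 1 / 4 else 0 := fun u => by
    simp [Function.update_eq_iff, ite_and]
  simp only [lamplighterWalk, hlast]
  rcases eq_or_ne x y with rfl | hxy
  · have hfirst : ∀ a, (∀ z, z ≠ x → Function.update f x a z = g z) ↔
        ∀ z, z ≠ x → z ≠ x → f z = g z := fun a =>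
      forall₂_congr fun z hz => by simp [hz]
    simp only [hfirst]
    split_ifs <;> simp
    norm_num
  · have hfirst : ∀ a, (∀ z, z ≠ y → Function.update f x a z = g z) ↔
        a = g x ∧ ∀ z, z ≠ x → z ≠ y → f z = g z := fun a => by
      refine ⟨fun h => ⟨by simpa using h x hxy, fun z hzx hzy => ?_⟩, fun h z hzy => ?_⟩
      · simpa [hzx] using h z hzy
      · rcases eq_or_ne z x with rfl | hzx
        · simp [h.1]
        · simp [hzx, h.2 z hzx hzy]
    simp [hfirst, ite_and, hxy]

theorem lamplighterWalk_lampFlip_lampFlip (P : Matrix V V ℝ) (o : V) (s t : (V → ZMod 2) × V) :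
    lamplighterWalk P (lampFlip o s) (lampFlip o t) = lamplighterWalk P s t := by
  simp [lamplighterWalk_apply, lampFlip]

theorem lamplighterWalk_lampFlip_left (P : Matrix V V ℝ) (s t : (V → ZMod 2) × V) :
    lamplighterWalk P (lampFlip s.2 s) t = lamplighterWalk P s t := by
  simp +contextual [lamplighterWalk_apply, lampFlip]

theorem sum_lamplighterWalk (P : Matrix V V ℝ) (s : (V → ZMod 2) × V) (y : V) :
    ∑ g, lamplighterWalk P s (g, y) = P s.2 y := by
  simp only [lamplighterWalk, ← mul_sum]
  rw [sum_comm]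
  simp only [sum_comm (s := univ (α := V → ZMod 2)), sum_ite_eq, mem_univ, if_true]
  norm_num

theorem lamplighterWalk_mulVec_comp_snd (P : Matrix V V ℝ) (v : V → ℝ) :
    lamplighterWalk P *ᵥ (v ∘ Prod.snd) = (P *ᵥ v) ∘ Prod.snd := by
  ext s
  simp only [mulVec, dotProduct, Function.comp_apply, Fintype.sum_prod_type_right, ← sum_mul,
    sum_lamplighterWalk]

theorem lamplighterWalk_mem_rowStochastic {P : Matrix V V ℝ} (hP : P ∈ rowStochastic ℝ V) :
    lamplighterWalk P ∈ rowStochastic ℝ ((V → ZMod 2) × V) := by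
  refine ⟨fun s t => mul_nonneg (nonneg_of_mem_rowStochastic hP) ?_, ?_⟩
  · exact sum_nonneg fun a _ => sum_nonneg fun b _ => by split_ifs <;> norm_num
  · exact (lamplighterWalk_mulVec_comp_snd P 1).trans <| by
      rw [one_vecMul_of_mem_rowStochastic hP]
      rfl

theorem lamplighterWalk_mulVec_comp_lampFlip (P : Matrix V V ℝ) (o : V)
    (F : (V → ZMod 2) × V → ℝ) :
    lamplighterWalk P *ᵥ (F ∘ lampFlip o) = (lamplighterWalk P *ᵥ F) ∘ lampFlip o := by
  ext s
  simp only [mulVec, dotProduct, Function.comp_apply]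
  rw [← Equiv.sum_comp (lampFlip_involutive o).toPerm]
  simp [lampFlip_involutive o _, ← lamplighterWalk_lampFlip_lampFlip P o s]

theorem lamplighterWalk_mulVec_lampDiff (P : Matrix V V ℝ) (o : V)
    (F : (V → ZMod 2) × V → ℝ) :
    lamplighterWalk P *ᵥ lampDiff o F = lampDiff o (lamplighterWalk P *ᵥ F) := by
  rw [lampDiff, mulVec_sub, lamplighterWalk_mulVec_comp_lampFlip, lampDiff]

/-- Visiting `o` refreshes the lamp there, which averages out any function odd in that lamp. -/
theorem lamplighterWalk_mulVec_eq_zero_of_odd (P : Matrix V V ℝ) {F : (V → ZMod 2) × V → ℝ}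
    {s : (V → ZMod 2) × V} (hF : F ∘ lampFlip s.2 = -F) : (lamplighterWalk P *ᵥ F) s = 0 := by
  have hodd : (lamplighterWalk P *ᵥ F) (lampFlip s.2 s) = -(lamplighterWalk P *ᵥ F) s := by
    have h := congrFun (lamplighterWalk_mulVec_comp_lampFlip P s.2 F) s
    rwa [hF, mulVec_neg, eq_comm] at h
  have heven : (lamplighterWalk P *ᵥ F) (lampFlip s.2 s) = (lamplighterWalk P *ᵥ F) s := by
    simp only [mulVec, dotProduct, lamplighterWalk_lampFlip_left]
  linarith

theorem lamplighterWalk_mulVec_lampLift {P : Matrix V V ℝ} {o : V} {μ : ℝ} {v : V → ℝ}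
    (hv : IsDirichletEigenfunction P o μ v) :
    lamplighterWalk P *ᵥ lampLift o v = μ • lampLift o v := by
  ext s
  rcases eq_or_ne s.2 o with rfl | hso
  · rw [lamplighterWalk_mulVec_eq_zero_of_odd P (lampLift_comp_lampFlip _ v)]
    simp [lampLift, hv.apply_self]
  let c : ℝ := if s.1 o = 0 then 1 else -1
  have hterm : ∀ t, lamplighterWalk P s t * lampLift o v t =
      c * (lamplighterWalk P s t * v t.2) := fun t => by
    rcases eq_or_ne t.2 o with hto | hto
    · simp [lampLift, hto, hv.apply_self]
    · by_cases hst : s.1 o = t.1 o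
      · simp only [lampLift, c, hst]
        split_ifs <;> ring
      · have : lamplighterWalk P s t = 0 := by
          rw [lamplighterWalk_apply, if_neg fun h => hst (h o hso.symm hto.symm)]
        simp [this]
  calc (lamplighterWalk P *ᵥ lampLift o v) s
      = c * (lamplighterWalk P *ᵥ (v ∘ Prod.snd)) s := by
        simp only [mulVec, dotProduct, hterm, ← mul_sum, Function.comp_apply]
    _ = (μ • lampLift o v) s := by
        rw [lamplighterWalk_mulVec_comp_snd, Function.comp_apply, hv.mulVec_apply _ hso]
        simp only [c, lampLift, Pi.smul_apply, smul_eq_mul]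
        split_ifs <;> ring

end LamplighterWalk

section LamplighterSpectrum

variable {V : Type*} [Fintype V] [DecidableEq V] [Nontrivial V] {P : Matrix V V ℝ}
  (hP : P ∈ rowStochastic ℝ V) {l : ℝ} {F : (V → ZMod 2) × V → ℝ}

theorem le_one_sub_inv_maxHittingTime_of_odd (hirr : P.IsIrreducible) {o : V} (hne : F ≠ 0)
    (heig : lamplighterWalk P *ᵥ F = l • F) (hodd : F ∘ lampFlip o = -F) :
    l ≤ 1 - (maxHittingTime P hP).toReal⁻¹ := by
  rcases le_or_gt l 0 with hl | hl
  · linarith [inv_le_one_of_one_le₀ (one_le_maxHittingTime hP hirr)]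
  let g : V → ℝ := fun x => ⨆ f, |F| (f, x)
  have hFg : |F| ≤ g ∘ Prod.snd := fun s =>
    le_ciSup (f := fun f => |F| (f, s.2)) (Finite.bddAbove_range _) s.1
  have hgo : g o = 0 := by
    have hFo : ∀ f, F (f, o) = 0 := fun f => by
      have h := lamplighterWalk_mulVec_eq_zero_of_odd P (s := (f, o)) hodd
      rw [heig] at h
      exact (mul_eq_zero.1 h).resolve_left hl.ne'
    simp [g, hFo]
  refine le_one_sub_inv_maxHittingTime_of_subeigenfunction hP hirr (g := g) (o := o)
    (fun x => (abs_nonneg _).trans (hFg (0, x))) (fun hg => hne (funext fun s => ?_)) hgo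
    fun x _ => ?_
  · exact abs_nonpos_iff.1 ((hFg s).trans_eq (congrFun hg s.2))
  · obtain ⟨f, hf⟩ := exists_eq_ciSup_of_finite (f := fun f => |F| (f, x))
    calc l * g x = |lamplighterWalk P *ᵥ F| (f, x) := by
          rw [heig, ← show |F| (f, x) = g x from hf]
          simp [abs_mul, abs_of_pos hl]
      _ ≤ (lamplighterWalk P *ᵥ |F|) (f, x) :=
          abs_mulVec_le_of_mem_rowStochastic (lamplighterWalk_mem_rowStochastic hP) F _
      _ ≤ (lamplighterWalk P *ᵥ (g ∘ Prod.snd)) (f, x) :=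
          mulVec_mono_of_mem_rowStochastic (lamplighterWalk_mem_rowStochastic hP) hFg _
      _ = (P *ᵥ g) x := by rw [lamplighterWalk_mulVec_comp_snd, Function.comp_apply]

theorem le_one_sub_inv_maxHittingTime_or_eq_comp_snd (hirr : P.IsIrreducible)
    (heig : lamplighterWalk P *ᵥ F = l • F) :
    l ≤ 1 - (maxHittingTime P hP).toReal⁻¹ ∨ ∃ v, F = v ∘ Prod.snd ∧ P *ᵥ v = l • v := by
  by_cases h : ∃ o, lampDiff o F ≠ 0
  · obtain ⟨o, ho⟩ := h
    refine .inl (le_one_sub_inv_maxHittingTime_of_odd hP hirr ho ?_ (lampDiff_comp_lampFlip o F))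
    rw [lamplighterWalk_mulVec_lampDiff, heig, lampDiff, lampDiff, smul_sub]
    rfl
  · push Not at h
    have hF := eq_comp_snd_of_comp_lampFlip_eq fun o => (sub_eq_zero.1 (h o)).symm
    refine .inr ⟨_, hF, funext fun x => ?_⟩
    rw [hF, lamplighterWalk_mulVec_comp_snd] at heig
    exact congrFun heig (0, x)

theorem lamplighterWalk_harmonic_eq_const (hP : P ∈ rowStochastic ℝ V) (hirr : P.IsIrreducible)
    (hF : lamplighterWalk P *ᵥ F = F) (s t : (V → ZMod 2) × V) : F s = F t := by
  rcases le_one_sub_inv_maxHittingTime_or_eq_comp_snd hP hirr (hF.trans (one_smul ℝ F).symm) with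
    hle | ⟨v, rfl, hv⟩
  · linarith [inv_pos.2 (zero_lt_one.trans_le (one_le_maxHittingTime hP hirr))]
  · exact eq_of_harmonic hP hirr (hv.trans (one_smul ℝ v)) s.2 t.2

theorem lamplighterWalk_eigenvalue_le (hirr : P.IsIrreducible) {π : V → ℝ} (hπ : ∀ x, 0 < π x)
    (hstat : π ᵥ* P = π) (hne : F ≠ 0) (heig : lamplighterWalk P *ᵥ F = l • F) (hl : l ≠ 1) :
    l ≤ 1 - (maxHittingTime P hP).toReal⁻¹ := by
  rcases le_one_sub_inv_maxHittingTime_or_eq_comp_snd hP hirr heig with hle | ⟨v, rfl, hv⟩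
  · exact hle
  · exact eigenvalue_le_one_sub_inv_maxHittingTime hP hirr hπ hstat
      (fun h => hne (by rw [h]; rfl)) hv hl

end LamplighterSpectrum

section RelaxationTime

theorem hasEigenvalue_toLin'_iff {S : Type*} [Fintype S] [DecidableEq S] {Q : Matrix S S ℝ}
    {l : ℝ} : Module.End.HasEigenvalue (toLin' Q) l ↔ ∃ u ≠ 0, Q *ᵥ u = l • u := by
  simp only [Module.End.HasEigenvalue, Module.End.HasUnifEigenvalue, Submodule.ne_bot_iff,
    Module.End.mem_eigenspace_iff, toLin'_apply]
  exact exists_congr fun u => and_comm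

theorem secondEigenvalue_eq_sSup {S : Type*} [Fintype S] [DecidableEq S] {Q : Matrix S S ℝ}
    (hQ : ∀ u : S → ℝ, Q *ᵥ u = u → ∀ s t, u s = u t) :
    secondEigenvalue Q = sSup {l : ℝ | l ≠ 1 ∧ ∃ u ≠ 0, Q *ᵥ u = l • u} := by
  have hconst : Module.End.eigenspace (toLin' Q) 1 ≤ Submodule.span ℝ {1} := fun u hu => by
    rw [Module.End.mem_eigenspace_iff, toLin'_apply, one_smul] at hu
    rcases isEmpty_or_nonempty S with _ | ⟨⟨s⟩⟩
    · exact Subsingleton.elim 0 u ▸ zero_mem _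
    · exact Submodule.mem_span_singleton.2 ⟨u s, funext fun t => by simp [hQ u hu t s]⟩
  have hsimple : Module.finrank ℝ (Module.End.eigenspace (toLin' Q) 1) ≤ 1 :=
    (Submodule.finrank_mono hconst).trans ((finrank_span_le_card {1}).trans (by simp))
  rw [secondEigenvalue]
  congr 1
  ext l
  simp only [Set.mem_ofPred_eq, hasEigenvalue_toLin'_iff, and_comm (a := l ≠ 1),
    (hsimple.trans_lt one_lt_two).not_ge, ne_eq, imp_false]

variable {V : Type*} [Fintype V] [DecidableEq V] [Nontrivial V] {P : Matrix V V ℝ}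
  (hP : P ∈ rowStochastic ℝ V) {π : V → ℝ}

theorem IsReversible.secondEigenvalue_lamplighterWalk_mem_Icc (hrev : IsReversible π P)
    (hirr : P.IsIrreducible) (hπ : ∀ x, 0 < π x) :
    secondEigenvalue (lamplighterWalk P) ∈ Set.Icc
      (1 - 2 * (maxHittingTime P hP).toReal⁻¹) (1 - (maxHittingTime P hP).toReal⁻¹) := by
  have hT : 0 < (maxHittingTime P hP).toReal :=
    zero_lt_one.trans_le (one_le_maxHittingTime hP hirr)
  obtain ⟨o, μ, v, hv, hμ⟩ := hrev.exists_one_sub_mul_maxHittingTime_le hP hirr hπ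
  rw [secondEigenvalue_eq_sSup fun F hF => lamplighterWalk_harmonic_eq_const hP hirr hF]
  set E := {l : ℝ | l ≠ 1 ∧ ∃ F ≠ 0, lamplighterWalk P *ᵥ F = l • F}
  have hupper : 1 - (maxHittingTime P hP).toReal⁻¹ ∈ upperBounds E := by
    rintro l ⟨hl, F, hF, heig⟩
    exact lamplighterWalk_eigenvalue_le hP hirr hπ (hrev.vecMul_eq hP) hF heig hl
  have hμE : μ ∈ E := by
    refine ⟨(hv.lt_one hP hirr).ne, lampLift o v, fun h => hv.ne_zero (funext fun x => ?_),
      lamplighterWalk_mulVec_lampLift hv⟩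
    simpa [lampLift] using congrFun h (0, x)
  refine ⟨?_, csSup_le ⟨μ, hμE⟩ hupper⟩
  refine le_trans ?_ (le_csSup ⟨_, hupper⟩ hμE)
  rw [sub_le_comm, ← div_eq_mul_inv]
  exact (le_div_iff₀ hT).2 hμ

theorem IsReversible.relaxationTime_lamplighterWalk_mem_Icc (hrev : IsReversible π P)
    (hirr : P.IsIrreducible) (hπ : ∀ x, 0 < π x) :
    relaxationTime (lamplighterWalk P) ∈ Set.Icc
      (1 / 2 * (maxHittingTime P hP).toReal) (maxHittingTime P hP).toReal := by
  obtain ⟨hlow, hupp⟩ := hrev.secondEigenvalue_lamplighterWalk_mem_Icc hP hirr hπ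
  have hT : 0 < (maxHittingTime P hP).toReal :=
    zero_lt_one.trans_le (one_le_maxHittingTime hP hirr)
  have hgap : 0 < 1 - secondEigenvalue (lamplighterWalk P) := by linarith [inv_pos.2 hT]
  rw [relaxationTime]
  constructor
  · rw [le_one_div (by positivity) hgap]
    calc _ ≤ 2 * (maxHittingTime P hP).toReal⁻¹ := by linarith
      _ = 1 / (1 / 2 * (maxHittingTime P hP).toReal) := by field_simp
  · rw [one_div_le hgap hT, one_div]
    linarith

end RelaxationTime

section LazyWalk

variable {V : Type*} [Fintype V] [DecidableEq V] {G : SimpleGraph V} [DecidableRel G.Adj]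

theorem isReversible_lazyWalk (G : SimpleGraph V) [DecidableRel G.Adj] :
    IsReversible (fun x => (G.degree x : ℝ)) (lazyWalk G) := fun x y => by
  rcases eq_or_ne x y with rfl | hxy
  · rfl
  by_cases hadj : G.Adj x y
  · have hx : (G.degree x : ℝ) ≠ 0 := mod_cast hadj.degree_pos_left.ne'
    have hy : (G.degree y : ℝ) ≠ 0 := mod_cast hadj.degree_pos_right.ne'
    simp only [lazyWalk, hxy, hxy.symm, hadj, hadj.symm, if_true, if_false]
    field_simp
  · simp [lazyWalk, hxy, hxy.symm, hadj, G.adj_comm y x]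

theorem lazyWalk_pos_of_adj {x y : V} (hxy : G.Adj x y) : 0 < lazyWalk G x y := by
  have hx : 0 < G.degree x := hxy.degree_pos_left
  rw [lazyWalk, if_neg hxy.ne, if_pos hxy]
  positivity

theorem isIrreducible_lazyWalk (hG : G.Connected) : (lazyWalk G).IsIrreducible where
  nonneg x y := by
    rw [lazyWalk]
    split_ifs <;> positivity
  connected x y := by
    let _ := toQuiver (lazyWalk G)
    obtain ⟨p⟩ : Nonempty (Quiver.Path x y) := by
      obtain ⟨walk⟩ := hG.preconnected x y
      induction walk with
      | nil => exact ⟨.nil⟩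
      | @cons u v _ hadj _ ih =>
        let step : u ⟶ v := ⟨lazyWalk_pos_of_adj hadj⟩
        exact ih.map step.toPath.comp
    let loop : y ⟶ y := ⟨by simp [lazyWalk]⟩
    exact ⟨p.cons loop, Nat.succ_pos _⟩

end LazyWalk

end Lamplighter

end

theorem mainTheorem2_general {V : Type*} [Fintype V] [DecidableEq V] [Nontrivial V]
    {P : Matrix V V ℝ} (hP : P ∈ Matrix.rowStochastic ℝ V) (hirr : P.IsIrreducible) {π : V → ℝ}
    (hπ : ∀ x, 0 < π x) (hrev : Lamplighter.IsReversible π P) :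
    let tHit : ℝ≥0∞ := Lamplighter.maxHittingTime P hP
    let tRelLamp : ℝ := Lamplighter.relaxationTime (Lamplighter.lamplighterWalk P)
    tHit ≠ ⊤ ∧ 1 / 2 * tHit.toReal ≤ tRelLamp ∧ tRelLamp ≤ tHit.toReal :=
  ⟨Lamplighter.maxHittingTime_ne_top hP hirr,
    hrev.relaxationTime_lamplighterWalk_mem_Icc hP hirr hπ⟩

theorem mainTheorem2 :
    ∃ c₁ C₁ : ℝ, 0 < c₁ ∧ c₁ ≤ C₁ ∧
      ∀ (V : Type*) [Fintype V] [DecidableEq V] [Nontrivial V]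
        (G : SimpleGraph V) [DecidableRel G.Adj] (d : ℕ) (_hreg : G.IsRegularOfDegree d)
        (hconn : G.Connected),
        let tHit : ℝ≥0∞ := Lamplighter.maxHittingTime (Lamplighter.lazyWalk G)
          (Lamplighter.lazyWalk_mem_rowStochastic G hconn)
        let tRel : ℝ := Lamplighter.relaxationTime (Lamplighter.lazyWalk G)
        let tRelLamp : ℝ := Lamplighter.relaxationTime
          (Lamplighter.lamplighterWalk (Lamplighter.lazyWalk G))
        tHit ≠ ⊤ ∧
        c₁ * tHit.toReal ≤ tRelLamp ∧
        tRelLamp ≤ C₁ * tHit.toReal ∧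
        tRelLamp ≤ max (4 / Real.log 2 * tHit.toReal) (2 * tRel) := by
  refine ⟨1 / 2, 1, by norm_num, by norm_num, fun V _ _ _ G _ _ _ hconn => ?_⟩
  obtain ⟨hfin, hlower, hupper⟩ := mainTheorem2_general
    (Lamplighter.lazyWalk_mem_rowStochastic G hconn) (Lamplighter.isIrreducible_lazyWalk hconn)
    (fun x => Nat.cast_pos.2 (hconn.preconnected.degree_pos_of_nontrivial x))
    (Lamplighter.isReversible_lazyWalk G)
  have hlog : 1 ≤ 4 / Real.log 2 := by
    rw [le_div_iff₀ (Real.log_pos one_lt_two)]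
    linarith [Real.log_le_sub_one_of_pos (zero_lt_two (α := ℝ))]
  exact ⟨hfin, hlower, hupper.trans_eq (one_mul _).symm, le_max_of_le_left
    (hupper.trans (le_mul_of_one_le_left ENNReal.toReal_nonneg hlog))⟩
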